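/- Notation. For $\alpha,\beta>0$ let $E_{\alpha,\beta}(x)=\sum_{k\ge0}x^k/\Gamma(\alpha k+\beta)$ be the Mittag-Leffler function. Let $0<T<\infty$. Functions in $W^{1,1}(0,T)$ are identified with their continuous representatives on $[0,T]$. For $v\in W^{1,1}(0,T)$ the Djirbashian-Caputo derivative is $$\partial_t^\alpha v(t)=\frac{1}{\Gamma(1-\alpha)}\int_0^t (t-s)^{-\alpha}v'(s)\,ds\quad(0<\alpha<1),\qquad \partial_t^1v=v'.$$ For $c_0>0$ and a function $\phi$ on $(0,T)$ consider the inequality $$\partial_t^\alpha\eta(t)+c_0\eta(t)\le\phi(t)\quad\text{for almost every }t\in(0,T).\tag{1}$$ (I) Let $\alpha\in(0,1)$. There is a constant $C(\alpha)>0$ depending only on $\alpha$ such that the following holds for all $T\in(0,\infty)$, $c_0>0$ and all $\eta\in W^{1,1}(0,T)$ with the property that for every $\underline t\in(0,T)$ there is $\beta\in(\alpha,1)$ with $\eta\in W^{1,1/(1-\beta)}(\underline t,T)$. (a) If (1) holds, then $$\eta(t)\le E_{\alpha,1}(-c_0t^\alpha)\,\eta(0)+\int_0^t(t-s)^{\alpha-1}E_{\alpha,\alpha}(-c_0(t-s)^\alpha)\phi(s)\,ds$$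 for every $t\in(0,T]$ for which the integral converges absolutely. (b) If (1) holds and $\eta\ge0$ almost everywhere on $(0,T)$, then $$\eta(t)\le\eta(0)+\frac1{\Gamma(\alpha)}\int_0^t(t-s)^{\alpha-1}\phi(s)\,ds$$ for every $t\in(0,T]$ for which the integral converges absolutely. (c) If (1) holds with $\phi(t)=\phi_0t^{-\alpha}$, $\phi_0\in\mathbb R$, and $\eta(0)\ge0$, then $$\eta(t)\le\Bigl(\frac{\Gamma(1+\alpha)}{c_0}\,\eta(0)+\frac{\phi_0\,C(\alpha)}{c_0}\Bigr)t^{-\alpha}\quad\text{for all }t\in(0,T].$$ (d) If (1) holds with $\phi(t)=\phi_0t^{-\alpha}$, $\phi_0\in\mathbb R$, and $\eta\ge0$ almost everywhere on $(0,T)$, then $$\eta(t)\le\eta(0)+\frac{\phi_0}{\Gamma(\alpha)\,\alpha(1-\alpha)}\quad\text{for all }t\in(0,T].$$ (e) If (1) holds with $\phi\equiv\phi_0$, and $\phi_0\ge0$, $\eta(0)\ge0$, then $\eta(t)\le\eta(0)+\phi_0/c_0$ for all $t\in(0,T]$. (II) Let $\alpha=1$; then $E_{1,1}=\exp$. Let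 $T\in(0,\infty)$, $c_0>0$ and $\eta\in W^{1,1}(0,T)$. (f) If (1) holds, then the estimate in (a) holds with $\alpha=1$, that is, $\eta(t)\le e^{-c_0t}\eta(0)+\int_0^te^{-c_0(t-s)}\phi(s)\,ds$ for every $t\in(0,T]$ for which the integral converges absolutely. (g) If (1) holds with $\phi(t)=\phi_0e^{-c_1t}$, $\phi_0\ge0$, $c_1>c_0$, then $$\eta(t)\le\Bigl(\eta(0)+\frac{\phi_0}{c_1-c_0}\Bigr)e^{-c_0t}\quad\text{for all }t\in(0,T].$$ -/

import Mathlib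

open MeasureTheory Set
open scoped ContDiff ENNReal

/-- The two-parameter Mittag-Leffler function
`E_{α,β}(x) = ∑_{k ≥ 0} x ^ k / Γ(α k + β)` at a real argument. -/
noncomputable def mittagLeffler (α β x : ℝ) : ℝ :=
  ∑' k : ℕ, x ^ k / Real.Gamma (α * k + β)

/-- `g` is a weak derivative of `u` on the interval `(a, b)`. -/
def IsWeakDerivOn (u g : ℝ → ℝ) (a b : ℝ) : Prop :=
  ∀ ψ : ℝ → ℝ, ContDiff ℝ ∞ ψ → HasCompactSupport ψ → tsupport ψ ⊆ Ioo a b →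
    ∫ x in Ioo a b, u x * deriv ψ x = -∫ x in Ioo a b, g x * ψ x

/-- `u` belongs to the Sobolev space `W^{1,p}(a, b)`. -/
def MemSobolevW1 (p : ℝ≥0∞) (a b : ℝ) (u : ℝ → ℝ) : Prop :=
  MemLp u p (volume.restrict (Ioo a b)) ∧
    ∃ g : ℝ → ℝ, MemLp g p (volume.restrict (Ioo a b)) ∧ IsWeakDerivOn u g a b

/-- The Djirbashian-Caputo derivative of order `α ∈ (0, 1]` of a `W^{1,1}` function:
the convolution of `s ^ (-α) / Γ(1 - α)` with `v'` if `α < 1`, and `v'` itself if `α = 1`.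
A continuous `W^{1,1}` function is absolutely continuous, so `deriv v` is its derivative
almost everywhere and represents its weak derivative. -/
noncomputable def caputoDeriv (α : ℝ) (v : ℝ → ℝ) (t : ℝ) : ℝ :=
  if α = 1 then deriv v t
  else ∫ s in (0 : ℝ)..t, (1 / Real.Gamma (1 - α)) * (t - s) ^ (-α) * deriv v s

/-- The differential inequality `∂_t^α η + c₀ η ≤ φ` almost everywhere on `(0, T)`. -/
def RelaxationInequality (α c₀ T : ℝ) (η φ : ℝ → ℝ) : Prop :=
  ∀ᵐ t ∂(volume.restrict (Ioo 0 T)), caputoDeriv α η t + c₀ * η t ≤ φ t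

/-- The integrand `(t - s) ^ (α - 1) E_{α,α}(-c₀ (t - s) ^ α) φ(s)`. -/
noncomputable def relaxationIntegrand (α c₀ : ℝ) (φ : ℝ → ℝ) (t s : ℝ) : ℝ :=
  (t - s) ^ (α - 1) * mittagLeffler α α (-c₀ * (t - s) ^ α) * φ s

/-- The comparison function `ν` with initial value `η₀`. -/
noncomputable def relaxationSolution (α c₀ η₀ : ℝ) (φ : ℝ → ℝ) (t : ℝ) : ℝ :=
  mittagLeffler α 1 (-c₀ * t ^ α) * η₀ + ∫ s in (0 : ℝ)..t, relaxationIntegrand α c₀ φ t s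

/-! Write `e`, `E`, `F` for the kernels `t ^ (β - 1) E_{α,β}(-c t ^ α)` with `β = α`, `1`, `α + 1`.
The idea is variation of constants: convolve the inequality with the resolvent `e`. Since `e` is
positive, the inequality survives, and the left side can be computed exactly.

The computation needs three facts. A `W^{1,1}` function is the integral of its derivative
(`MemSobolevW1.integral_deriv_eq_sub`). Fractional integration of order `γ` raises `β` by `γ`
(`integral_rpow_mul_mittagLefflerKernel`), so `e` convolved with the Caputo kernel is `E`, and with
`1` is `F`. Finally `E = 1 - c F`. Associativity of convolution (`integral_mul_convolution_eq`) then
turns `e * (∂^α η + c η)` into `η t - E t * η 0`.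

Positivity (`mittagLefflerKernel_pos`) comes from the Volterra equation for `e`, by a first-zero
argument using that `(t₀ - s) ^ (α - 1) / (t₁ - s) ^ (α - 1)` is largest at `s = 0`. It gives `E ≥
0` for `α < 1`, `F` increasing, and hence the decay `E ≤ Γ(1 + α) / (c t ^ α)`.

The remaining bounds evaluate `e * φ` for the particular `φ`. When `η ≥ 0`, the term `c η` may be
dropped and the same comparison applied with `c = 0`. For `φ = φ₀ t ^ (-α)` no sign of `φ₀` is
assumed; continuity of `η` at `0` forces `φ₀ ≥ 0`. -/

/-! ### Weak derivatives and the fundamental theorem of calculus -/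

/-- A smooth function with compact support in `(a, b)` and vanishing integral is the derivative of
a smooth function with compact support in `(a, b)`. -/
lemma exists_deriv_eq_of_integral_eq_zero {a b : ℝ} {θ : ℝ → ℝ} (hθ : ContDiff ℝ ∞ θ)
    (hc : HasCompactSupport θ) (hs : tsupport θ ⊆ Ioo a b) (h0 : ∫ x, θ x = 0) :
    ∃ ψ : ℝ → ℝ, ContDiff ℝ ∞ ψ ∧ HasCompactSupport ψ ∧ tsupport ψ ⊆ Ioo a b ∧
      ∀ x, deriv ψ x = θ x := by
  rcases (tsupport θ).eq_empty_or_nonempty with he | hne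
  · have hz : θ = 0 := tsupport_eq_empty_iff.mp he
    refine ⟨0, contDiff_const, HasCompactSupport.zero, ?_, fun x => ?_⟩
    · simp [tsupport]
    · simp [hz]
  -- The primitive vanishes left of the support trivially and right of it because the total integral
  -- is zero; the extreme points of the support keep `[a', b']` strictly inside `(a, b)`.
  obtain ⟨a', ha', hlo⟩ := hc.isCompact.exists_isLeast hne
  obtain ⟨b', hb', hhi⟩ := hc.isCompact.exists_isGreatest hne
  have haa := (hs ha').1
  have hbb := (hs hb').2
  have hzero : ∀ x, x ∉ Icc a' b' → θ x = 0 := fun x hx => by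
    by_contra hne
    have hm : x ∈ tsupport θ := subset_tsupport _ hne
    exact hx ⟨hlo hm, hhi hm⟩
  have hd : ∀ x, HasDerivAt (fun x => ∫ y in a..x, θ y) (θ x) x := fun x =>
    intervalIntegral.integral_hasDerivAt_right (hθ.continuous.intervalIntegrable _ _)
      hθ.continuous.stronglyMeasurable.stronglyMeasurableAtFilter hθ.continuous.continuousAt
  have hderiv : deriv (fun x => ∫ y in a..x, θ y) = θ := funext fun x => (hd x).deriv
  have hout : ∀ x, x ∉ Icc a' b' → ∫ y in a..x, θ y = 0 := by
    intro x hx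
    by_cases hxa : x < a'
    · refine intervalIntegral.integral_zero_ae (Filter.Eventually.of_forall fun y hy => ?_)
      refine hzero y fun hy' => ?_
      rw [mem_uIoc] at hy
      rcases hy with hy | hy <;> linarith [hy.2, hy'.1]
    · have hxb : b' < x := by
        by_contra h
        exact hx ⟨not_lt.mp hxa, not_lt.mp h⟩
      have hab' : a' ≤ b' := hlo hb'
      rw [intervalIntegral.integral_of_le (by linarith), ← h0]
      refine setIntegral_eq_integral_of_forall_compl_eq_zero fun y hy => hzero y fun hy' => ?_
      exact hy ⟨by linarith [hy'.1], by linarith [hy'.2]⟩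
  have hts : tsupport (fun x => ∫ y in a..x, θ y) ⊆ Icc a' b' := by
    refine closure_minimal (fun x hx => ?_) isClosed_Icc
    by_contra h
    exact hx (hout x h)
  refine ⟨fun x => ∫ y in a..x, θ y, ?_, ?_, ?_, fun x => (hd x).deriv⟩
  · rw [contDiff_infty_iff_deriv, hderiv]
    exact ⟨fun x => (hd x).differentiableAt, hθ⟩
  · exact isCompact_Icc.of_isClosed_subset (isClosed_tsupport _) hts
  · exact hts.trans fun x hx => ⟨by linarith [hx.1], by linarith [hx.2]⟩

/-- A continuous function whose weak derivative vanishes is constant. -/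
lemma exists_eq_const_of_isWeakDerivOn_zero {a b : ℝ} (hab : a < b) {w : ℝ → ℝ}
    (hw : ContinuousOn w (Icc a b)) (h : IsWeakDerivOn w 0 a b) :
    ∃ c, ∀ x ∈ Icc a b, w x = c := by
  let bump : ContDiffBump ((a + b) / 2) :=
    ⟨(b - a) / 4, (b - a) / 3, by linarith, by linarith⟩
  set ρ : ℝ → ℝ := bump.normed volume with hρ
  have hρd : ContDiff ℝ ∞ ρ := bump.contDiff_normed
  have hρc : HasCompactSupport ρ := bump.hasCompactSupport_normed
  have hρi : ∫ x, ρ x = 1 := bump.integral_normed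
  have hρs : tsupport ρ ⊆ Ioo a b := by
    rw [hρ, bump.tsupport_normed_eq, Real.closedBall_eq_Icc]
    intro x hx
    have h1 : bump.rOut = (b - a) / 3 := rfl
    rw [h1] at hx
    exact ⟨by linarith [hx.1], by linarith [hx.2]⟩
  have hint : ∀ χ : ℝ → ℝ, ContDiff ℝ ∞ χ → IntegrableOn (fun x => w x * χ x) (Ioo a b) :=
    fun χ hχ => ((hw.mul hχ.continuous.continuousOn).integrableOn_Icc).mono_set Ioo_subset_Icc_self
  set c := ∫ x in Ioo a b, w x * ρ x with hc
  -- Du Bois-Reymond: `χ - (∫ χ) ρ` has mean zero, so it is the derivative of a test function.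
  -- Testing `w` against it gives `∫ w χ = (∫ χ) c`.
  have key : ∀ χ : ℝ → ℝ, ContDiff ℝ ∞ χ → HasCompactSupport χ → tsupport χ ⊆ Ioo a b →
      ∫ x, χ x • (w x - c) = 0 := by
    intro χ hχ hχc hχs
    have hθs : tsupport (fun x => χ x - (∫ y, χ y) * ρ x) ⊆ tsupport χ ∪ tsupport ρ := by
      refine closure_minimal (fun x hx => ?_)
        ((isClosed_tsupport χ).union (isClosed_tsupport ρ))
      by_contra hn
      rw [mem_union, not_or] at hn
      exact hx (by simp [image_eq_zero_of_notMem_tsupport hn.1,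
        image_eq_zero_of_notMem_tsupport hn.2])
    have hθc : HasCompactSupport (fun x => χ x - (∫ y, χ y) * ρ x) :=
      (hχc.isCompact.union hρc.isCompact).of_isClosed_subset (isClosed_tsupport _) hθs
    obtain ⟨ψ, hψ, hψc, hψs, hψd⟩ := exists_deriv_eq_of_integral_eq_zero
      (θ := fun x => χ x - (∫ y, χ y) * ρ x) (a := a) (b := b)
      (hχ.sub (contDiff_const.mul hρd)) hθc (hθs.trans (union_subset hχs hρs)) (by
        rw [integral_sub (hχ.continuous.integrable_of_hasCompactSupport hχc)
          ((hρd.continuous.integrable_of_hasCompactSupport hρc).const_mul _),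
          integral_const_mul, hρi]; ring)
    have h1 := h ψ hψ hψc hψs
    simp only [hψd, Pi.zero_apply, zero_mul, integral_zero, neg_zero] at h1
    have h2 : ∫ x in Ioo a b, w x * χ x = (∫ y, χ y) * c := by
      have h3 : ∫ x in Ioo a b, w x * (χ x - (∫ y, χ y) * ρ x)
          = (∫ x in Ioo a b, w x * χ x) - (∫ y, χ y) * c := by
        rw [hc, ← integral_const_mul, ← integral_sub (hint χ hχ) ((hint ρ hρd).const_mul _)]
        congr 1 with x
        ring
      linarith
    have h4 : ∀ x, x ∉ Ioo a b → χ x = 0 := fun x hx =>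
      image_eq_zero_of_notMem_tsupport fun hx' => hx (hχs hx')
    rw [← setIntegral_eq_integral_of_forall_compl_eq_zero (s := Ioo a b)
      (fun x hx => by simp [h4 x hx])]
    rw [← setIntegral_eq_integral_of_forall_compl_eq_zero (s := Ioo a b) (f := χ) h4] at h2
    have h5 : ∫ x in Ioo a b, χ x • (w x - c)
        = (∫ x in Ioo a b, w x * χ x) - (∫ x in Ioo a b, χ x) * c := by
      rw [← integral_mul_const, ← integral_sub (hint χ hχ)
        (((hχ.continuous.integrable_of_hasCompactSupport hχc).integrableOn).mul_const c)]
      congr 1 with x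
      simp only [smul_eq_mul]
      ring
    rw [h5, h2, sub_self]
  have hloc : LocallyIntegrableOn (fun x => w x - c) (Ioo a b) :=
    IntegrableOn.locallyIntegrableOn
      (((hw.sub continuousOn_const).integrableOn_Icc).mono_set Ioo_subset_Icc_self)
  have hae := isOpen_Ioo.ae_eq_zero_of_integral_contDiff_smul_eq_zero hloc key
  have hae' : w =ᵐ[volume.restrict (Icc a b)] fun _ => c := by
    rw [← restrict_Ioo_eq_restrict_Icc]
    exact (ae_restrict_iff' measurableSet_Ioo).mpr (hae.mono fun x hx hx' => by linarith [hx hx'])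
  exact ⟨c, Measure.eqOn_Icc_of_ae_eq volume hab.ne hae' hw continuousOn_const⟩

/-- The continuous representative of a `W^{1,1}` function is the integral of its derivative. -/
theorem MemSobolevW1.integral_deriv_eq_sub {T : ℝ} {η : ℝ → ℝ} (hT : 0 < T)
    (h : MemSobolevW1 1 0 T η) (hη : ContinuousOn η (Icc 0 T)) :
    IntervalIntegrable (deriv η) volume 0 T ∧
      ∀ t ∈ Icc 0 T, ∫ s in (0 : ℝ)..t, deriv η s = η t - η 0 := by
  obtain ⟨-, g, hg, hweak⟩ := h
  have hgi : IntervalIntegrable g volume 0 T := by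
    rw [intervalIntegrable_iff_integrableOn_Ioo_of_le hT.le]
    exact memLp_one_iff_integrable.mp hg
  set G : ℝ → ℝ := fun x => ∫ y in (0 : ℝ)..x, g y with hG
  have hGac : AbsolutelyContinuousOnInterval G 0 T :=
    hgi.absolutelyContinuousOnInterval_intervalIntegral (c := 0) (by simp)
  have hGc : ContinuousOn G (Icc 0 T) := by simpa [uIcc_of_le hT.le] using hGac.continuousOn
  have hGd : ∀ᵐ x, x ∈ uIcc 0 T → deriv G x = g x := by
    filter_upwards [hgi.ae_hasDerivAt_integral] with x hx hx'
    exact (hx hx' 0 (by simp)).deriv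
  have hint : ∀ u χ : ℝ → ℝ, ContinuousOn u (Icc 0 T) → Continuous χ →
      IntegrableOn (fun x => u x * χ x) (Ioo 0 T) :=
    fun u χ hu hχ => ((hu.mul hχ.continuousOn).integrableOn_Icc).mono_set Ioo_subset_Icc_self
  -- The primitive `G` of the weak derivative is absolutely continuous, so integration by parts
  -- makes `g` its weak derivative too; the difference `η - G` is then constant.
  obtain ⟨c, hc⟩ := exists_eq_const_of_isWeakDerivOn_zero (w := fun x => η x - G x) hT
    (hη.sub hGc) (by
      intro ψ hψ hψc hψs
      have h1 := hweak ψ hψ hψc hψs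
      have hψ0 : ∀ x, x ∉ Ioo 0 T → ψ x = 0 := fun x hx =>
        image_eq_zero_of_notMem_tsupport fun hx' => hx (hψs hx')
      have h2 := hGac.integral_mul_deriv_eq_deriv_mul
        (hψ.of_le (by norm_cast)).contDiffOn.absolutelyContinuousOnInterval
      have h3 : ∫ x in (0 : ℝ)..T, deriv G x * ψ x = ∫ x in (0 : ℝ)..T, g x * ψ x := by
        refine intervalIntegral.integral_congr_ae ?_
        filter_upwards [hGd] with x hx hx'
        rw [hx (uIoc_subset_uIcc hx')]
      rw [h3, hψ0 0 (by simp), hψ0 T (by simp), intervalIntegral.integral_of_le hT.le,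
        intervalIntegral.integral_of_le hT.le, integral_Ioc_eq_integral_Ioo,
        integral_Ioc_eq_integral_Ioo] at h2
      have hd : Continuous (deriv ψ) := hψ.continuous_deriv (by norm_cast)
      have h4 : ∫ x in Ioo 0 T, (η x - G x) * deriv ψ x
          = (∫ x in Ioo 0 T, η x * deriv ψ x) - ∫ x in Ioo 0 T, G x * deriv ψ x := by
        rw [← integral_sub (hint η _ hη hd) (hint G _ hGc hd)]
        congr 1 with x
        ring
      rw [h4]
      simp only [Pi.zero_apply, zero_mul, integral_zero]
      linarith)
  have hderiv : ∀ᵐ x, x ∈ Ioo 0 T → deriv η x = g x := by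
    filter_upwards [hGd] with x hx hx'
    rw [← hx (by rw [uIcc_of_le hT.le]; exact Ioo_subset_Icc_self hx')]
    have hev : η =ᶠ[nhds x] fun y => G y + c := by
      filter_upwards [Ioo_mem_nhds hx'.1 hx'.2] with y hy
      linarith [hc y (Ioo_subset_Icc_self hy)]
    rw [hev.deriv_eq, deriv_add_const]
  have hderiv' : ∀ᵐ x, x ∈ uIoc 0 T → g x = deriv η x := by
    filter_upwards [hderiv, (measure_eq_zero_iff_ae_notMem.mp (measure_singleton T) :
      ∀ᵐ x, x ∉ ({T} : Set ℝ))] with x hx hxT hx'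
    rw [uIoc_of_le hT.le] at hx'
    exact (hx ⟨hx'.1, lt_of_le_of_ne hx'.2 hxT⟩).symm
  refine ⟨hgi.congr_ae ((ae_restrict_iff' measurableSet_uIoc).mpr hderiv'), fun t ht => ?_⟩
  have h0 := hc 0 ⟨le_rfl, hT.le⟩
  have h1 := hc t ht
  have h2 : ∫ s in (0 : ℝ)..t, deriv η s = G t := by
    refine intervalIntegral.integral_congr_ae ?_
    filter_upwards [hderiv'] with x hx hx'
    refine (hx ?_).symm
    rw [uIoc_of_le ht.1] at hx'
    rw [uIoc_of_le hT.le]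
    exact ⟨hx'.1, hx'.2.trans ht.2⟩
  have h3 : G 0 = 0 := by simp [hG]
  rw [h2]
  linarith

/-! ### The Mittag-Leffler function -/

/-- Restrict Euler's integral to `(R, ∞)`, where `x ^ (y - 1)` is at least `R ^ (y - 1)`. As `R` is
free, Gamma outgrows every geometric sequence. -/
lemma Real.rpow_mul_exp_neg_le_Gamma {R y : ℝ} (hR : 0 < R) (hy : 1 ≤ y) :
    R ^ (y - 1) * Real.exp (-R) ≤ Real.Gamma y := by
  have hi := Real.GammaIntegral_convergent (by linarith : 0 < y)
  have hsub : Ioi R ⊆ Ioi (0 : ℝ) := Ioi_subset_Ioi hR.le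
  rw [Real.Gamma_eq_integral (by linarith : 0 < y)]
  calc R ^ (y - 1) * Real.exp (-R) = ∫ x in Ioi R, R ^ (y - 1) * Real.exp (-x) := by
        rw [integral_const_mul, integral_exp_neg_Ioi]
    _ ≤ ∫ x in Ioi R, Real.exp (-x) * x ^ (y - 1) := by
        refine setIntegral_mono_on ((integrableOn_exp_neg_Ioi R).const_mul _) (hi.mono_set hsub)
          measurableSet_Ioi fun x hx => ?_
        have hx' : R < x := hx
        rw [mul_comm]
        gcongr
    _ ≤ ∫ x in Ioi 0, Real.exp (-x) * x ^ (y - 1) := by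
        refine setIntegral_mono_set hi ?_ (Filter.Eventually.of_forall hsub)
        refine (ae_restrict_iff' measurableSet_Ioi).mpr (Filter.Eventually.of_forall fun x hx => ?_)
        have hx0 : (0 : ℝ) < x := hx
        simp only [Pi.zero_apply]
        positivity

lemma summable_mittagLeffler {α β : ℝ} (hα : 0 < α) (hβ : 0 < β) (x : ℝ) :
    Summable fun k : ℕ => x ^ k / Real.Gamma (α * k + β) := by
  -- With `R ^ α = A`, the bound on Gamma makes the `k`-th term at most a constant times `(|x| / A)
  -- ^ k`, hence times `2 ^ (-k)`. The `+ 1` keeps `A` positive at `x = 0`.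
  set A : ℝ := 2 * (|x| + 1) with hA
  have hA0 : 0 < A := by positivity
  set R : ℝ := A ^ (1 / α) with hRdef
  have hR : 0 < R := by positivity
  have hRA : R ^ α = A := by
    rw [hRdef, ← Real.rpow_mul hA0.le, one_div_mul_cancel hα.ne', Real.rpow_one]
  refine Summable.of_norm_bounded_eventually_nat
    (g := fun k => Real.exp R * R ^ (1 - β) * (1 / 2 : ℝ) ^ k)
    ((summable_geometric_of_lt_one (by norm_num) (by norm_num)).mul_left _) ?_
  obtain ⟨N, hN⟩ := exists_nat_gt (1 / α)
  filter_upwards [Filter.eventually_ge_atTop N] with k hk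
  have hk' : 1 ≤ α * k + β := by
    have h1 : 1 / α < k := hN.trans_le (by exact_mod_cast hk)
    rw [div_lt_iff₀ hα] at h1
    linarith
  have hG := Real.rpow_mul_exp_neg_le_Gamma hR hk'
  have hG0 : 0 < Real.Gamma (α * k + β) := Real.Gamma_pos_of_pos (by linarith)
  have hpow : R ^ (α * k + β - 1) = A ^ k * R ^ (β - 1) := by
    rw [show α * k + β - 1 = α * k + (β - 1) by ring, Real.rpow_add hR, Real.rpow_mul hR.le, hRA,
      Real.rpow_natCast]
  have hx : |x| ^ k ≤ (1 / 2 : ℝ) ^ k * A ^ k := by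
    rw [← mul_pow]
    gcongr
    rw [hA]
    linarith
  have hone : Real.exp R * R ^ (1 - β) * (R ^ (β - 1) * Real.exp (-R)) = 1 := by
    rw [show Real.exp R * R ^ (1 - β) * (R ^ (β - 1) * Real.exp (-R))
      = (Real.exp R * Real.exp (-R)) * (R ^ (1 - β) * R ^ (β - 1)) by ring,
      ← Real.exp_add, ← Real.rpow_add hR]
    simp
  rw [norm_div, norm_pow, Real.norm_eq_abs, Real.norm_of_nonneg hG0.le, div_le_iff₀ hG0]
  calc |x| ^ k ≤ (1 / 2 : ℝ) ^ k * A ^ k := hx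
    _ = (Real.exp R * R ^ (1 - β) * (R ^ (β - 1) * Real.exp (-R))) * ((1 / 2 : ℝ) ^ k * A ^ k) := by
        rw [hone, one_mul]
    _ = Real.exp R * R ^ (1 - β) * (1 / 2 : ℝ) ^ k * (R ^ (α * k + β - 1) * Real.exp (-R)) := by
        rw [hpow]; ring
    _ ≤ _ := by gcongr

lemma continuous_mittagLeffler {α β : ℝ} (hα : 0 < α) (hβ : 0 < β) :
    Continuous (mittagLeffler α β) := by
  rw [continuous_iff_continuousAt]
  intro x
  have h : ContinuousOn (mittagLeffler α β) (Icc (-(|x| + 1)) (|x| + 1)) := by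
    refine continuousOn_tsum (fun k => by fun_prop) (summable_mittagLeffler hα hβ (|x| + 1))
      fun k y hy => ?_
    have hG0 : 0 < Real.Gamma (α * k + β) := Real.Gamma_pos_of_pos (by positivity)
    rw [norm_div, norm_pow, Real.norm_eq_abs, Real.norm_of_nonneg hG0.le]
    gcongr
    exact abs_le.mpr hy
  refine h.continuousAt (Icc_mem_nhds ?_ ?_)
  · linarith [neg_abs_le x]
  · linarith [le_abs_self x]

lemma mittagLeffler_zero {α β : ℝ} : mittagLeffler α β 0 = 1 / Real.Gamma β := by
  rw [mittagLeffler, tsum_eq_single 0 fun k hk => by simp [hk]]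
  simp

lemma mittagLeffler_one_one (x : ℝ) : mittagLeffler 1 1 x = Real.exp x := by
  rw [mittagLeffler, Real.exp_eq_exp_ℝ, NormedSpace.exp_eq_tsum_div]
  refine tsum_congr fun k => ?_
  rw [one_mul, Real.Gamma_nat_eq_factorial]

/-- The function `t ^ (β - 1) E_{α,β}(lam t ^ α)`. -/
noncomputable def mittagLefflerKernel (α lam β t : ℝ) : ℝ :=
  t ^ (β - 1) * mittagLeffler α β (lam * t ^ α)

lemma hasSum_mittagLefflerKernel {α β : ℝ} (hα : 0 < α) (hβ : 0 < β) (lam : ℝ) {t : ℝ}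
    (ht : 0 < t) :
    HasSum (fun k : ℕ => lam ^ k * (t ^ (α * k + β - 1) / Real.Gamma (α * k + β)))
      (mittagLefflerKernel α lam β t) := by
  have h := ((summable_mittagLeffler hα hβ (lam * t ^ α)).hasSum).mul_left (t ^ (β - 1))
  refine h.congr_fun fun k => ?_
  rw [show α * k + β - 1 = (β - 1) + α * k by ring, Real.rpow_add ht, Real.rpow_mul ht.le,
    Real.rpow_natCast, mul_pow]
  ring

/-- Split off the term `k = 0` of the series and shift the index. -/
lemma mittagLefflerKernel_eq_add {α β : ℝ} (hα : 0 < α) (hβ : 0 < β) (lam : ℝ) {t : ℝ}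
    (ht : 0 < t) :
    mittagLefflerKernel α lam β t
      = t ^ (β - 1) / Real.Gamma β + lam * mittagLefflerKernel α lam (β + α) t := by
  have h := hasSum_mittagLefflerKernel hα hβ lam ht
  have h' := (hasSum_mittagLefflerKernel hα (by linarith : 0 < β + α) lam ht).mul_left lam
  rw [← h.tsum_eq, h.summable.tsum_eq_zero_add, ← h'.tsum_eq]
  congr 1
  · simp
  · refine tsum_congr fun k => ?_
    rw [show α * ((k + 1 : ℕ) : ℝ) + β = α * k + (β + α) by push_cast; ring]
    ring

lemma integral_rpow_mul_rpow {γ b t : ℝ} (hγ : 0 < γ) (hb : 0 < b) (ht : 0 < t) :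
    ∫ s in (0 : ℝ)..t, (t - s) ^ (γ - 1) * s ^ (b - 1)
      = t ^ (b + γ - 1) * (Real.Gamma b * Real.Gamma γ / Real.Gamma (b + γ)) := by
  have h := Complex.betaIntegral_scaled b γ ht
  rw [Complex.betaIntegral_eq_Gamma_mul_div _ _ (by simpa) (by simpa)] at h
  have h1 : ∫ s in (0 : ℝ)..t, (s : ℂ) ^ ((b : ℂ) - 1) * ((t : ℂ) - s) ^ ((γ : ℂ) - 1)
      = ((∫ s in (0 : ℝ)..t, (t - s) ^ (γ - 1) * s ^ (b - 1) : ℝ) : ℂ) := by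
    rw [← intervalIntegral.integral_ofReal]
    refine intervalIntegral.integral_congr fun s hs => ?_
    rw [uIcc_of_le ht.le] at hs
    rw [Complex.ofReal_mul, Complex.ofReal_cpow (by linarith [hs.2]), Complex.ofReal_cpow hs.1]
    push_cast
    ring
  rw [h1, ← Complex.ofReal_add, Complex.Gamma_ofReal, Complex.Gamma_ofReal, Complex.Gamma_ofReal,
    ← Complex.ofReal_one, ← Complex.ofReal_sub, ← Complex.ofReal_cpow ht.le] at h
  exact_mod_cast h

lemma intervalIntegrable_rpow_mul_rpow {γ b t : ℝ} (hγ : 0 < γ) (hb : 0 < b) (ht : 0 < t) :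
    IntervalIntegrable (fun s => (t - s) ^ (γ - 1) * s ^ (b - 1)) volume 0 t := by
  -- A non-integrable function has integral `0` by convention, so the positive Beta value already
  -- proves integrability.
  refine intervalIntegral.intervalIntegrable_of_integral_ne_zero ?_
  rw [integral_rpow_mul_rpow hγ hb ht]
  have h1 := Real.Gamma_pos_of_pos hγ
  have h2 := Real.Gamma_pos_of_pos hb
  have h3 := Real.Gamma_pos_of_pos (add_pos hb hγ)
  positivity

lemma continuous_mittagLeffler_mul_rpow {α β : ℝ} (hα : 0 < α) (hβ : 0 < β) (lam : ℝ) :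
    Continuous fun t : ℝ => mittagLeffler α β (lam * t ^ α) :=
  (continuous_mittagLeffler hα hβ).comp (continuous_const.mul (Real.continuous_rpow_const hα.le))

lemma intervalIntegrable_rpow_mul_mittagLefflerKernel {α β γ : ℝ} (hα : 0 < α) (hβ : 0 < β)
    (hγ : 0 < γ) (lam : ℝ) {t : ℝ} (ht : 0 < t) :
    IntervalIntegrable (fun s => (t - s) ^ (γ - 1) * mittagLefflerKernel α lam β s)
      volume 0 t := by
  refine ((intervalIntegrable_rpow_mul_rpow hγ hβ ht).mul_continuousOn
    (continuous_mittagLeffler_mul_rpow hα hβ lam).continuousOn).congr fun s _ => ?_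
  simp only [mittagLefflerKernel]
  ring

/-- The fractional integral of order `γ` raises the second parameter by `γ`. -/
theorem integral_rpow_mul_mittagLefflerKernel {α β γ : ℝ} (hα : 0 < α) (hβ : 0 < β)
    (hγ : 0 < γ) (lam : ℝ) {t : ℝ} (ht : 0 < t) :
    ∫ s in (0 : ℝ)..t, (t - s) ^ (γ - 1) * mittagLefflerKernel α lam β s
      = Real.Gamma γ * mittagLefflerKernel α lam (β + γ) t := by
  have hG := Real.Gamma_pos_of_pos hγ
  have hb : ∀ k : ℕ, 0 < α * k + β := fun k => by positivity
  set f : ℕ → ℝ → ℝ := fun k s =>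
    (t - s) ^ (γ - 1) * (lam ^ k * (s ^ (α * k + β - 1) / Real.Gamma (α * k + β))) with hf
  have hfe : ∀ k s, f k s = lam ^ k / Real.Gamma (α * k + β) *
      ((t - s) ^ (γ - 1) * s ^ (α * k + β - 1)) := fun k s => by simp only [hf]; ring
  -- Needed with `μ = lam` for the values and with `μ = |lam|` for the norms that justify termwise
  -- integration.
  have hval : ∀ (μ : ℝ) (k : ℕ), μ ^ k / Real.Gamma (α * k + β) *
      (t ^ (α * k + β + γ - 1) * (Real.Gamma (α * k + β) * Real.Gamma γ /
        Real.Gamma (α * k + β + γ)))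
      = Real.Gamma γ * (μ ^ k * (t ^ (α * k + (β + γ) - 1) / Real.Gamma (α * k + (β + γ)))) := by
    intro μ k
    have := (Real.Gamma_pos_of_pos (hb k)).ne'
    rw [← add_assoc]
    field_simp
  have hint : ∀ k, ∫ s in Ioc 0 t, f k s
      = Real.Gamma γ * (lam ^ k * (t ^ (α * k + (β + γ) - 1) / Real.Gamma (α * k + (β + γ)))) := by
    intro k
    simp_rw [hfe]
    rw [integral_const_mul, ← intervalIntegral.integral_of_le ht.le,
      integral_rpow_mul_rpow hγ (hb k) ht, hval]
  have hintn : ∀ k, ∫ s in Ioc 0 t, ‖f k s‖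
      = Real.Gamma γ * (|lam| ^ k * (t ^ (α * k + (β + γ) - 1) /
        Real.Gamma (α * k + (β + γ)))) := by
    intro k
    rw [← hval, ← integral_rpow_mul_rpow hγ (hb k) ht, intervalIntegral.integral_of_le ht.le,
      ← integral_const_mul]
    refine setIntegral_congr_fun measurableSet_Ioc fun s hs => ?_
    have h1 : 0 ≤ t - s := by linarith [hs.2]
    have h2 : 0 ≤ s := hs.1.le
    have h3 := Real.Gamma_pos_of_pos (hb k)
    simp only [hfe]
    rw [norm_mul, norm_div, norm_pow, Real.norm_eq_abs, Real.norm_of_nonneg h3.le,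
      Real.norm_of_nonneg (by positivity)]
  have hsum := hasSum_integral_of_summable_integral_norm (μ := volume.restrict (Ioc 0 t)) (F := f)
    (fun k => by
      have h := ((intervalIntegrable_rpow_mul_rpow hγ (hb k) ht).const_mul
        (lam ^ k / Real.Gamma (α * k + β)))
      rw [intervalIntegrable_iff_integrableOn_Ioc_of_le ht.le] at h
      exact h.congr_fun (fun s _ => (hfe k s).symm) measurableSet_Ioc)
    (by
      simp_rw [hintn]
      exact ((hasSum_mittagLefflerKernel hα (add_pos hβ hγ) |lam| ht).mul_left _).summable)
  simp_rw [hint] at hsum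
  have huniq := hsum.unique
    ((hasSum_mittagLefflerKernel hα (add_pos hβ hγ) lam ht).mul_left (Real.Gamma γ))
  rw [← huniq, intervalIntegral.integral_of_le ht.le]
  refine setIntegral_congr_fun measurableSet_Ioc fun s hs => ?_
  simp only [hf]
  rw [tsum_mul_left, (hasSum_mittagLefflerKernel hα hβ lam hs.1).tsum_eq]

/-! ### Positivity and decay -/

lemma continuousOn_mittagLefflerKernel {α β : ℝ} (hα : 0 < α) (hβ : 0 < β) (lam : ℝ) :
    ContinuousOn (mittagLefflerKernel α lam β) (Ioi 0) :=
  (continuousOn_id.rpow_const fun _ ht => Or.inl (ne_of_gt ht)).mul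
    (continuous_mittagLeffler_mul_rpow hα hβ lam).continuousOn

/-- The Volterra resolvent equation, from which positivity is derived. -/
lemma Gamma_mul_mittagLefflerKernel_self {α : ℝ} (hα : 0 < α) (c : ℝ) {t : ℝ} (ht : 0 < t) :
    Real.Gamma α * mittagLefflerKernel α (-c) α t
      = t ^ (α - 1) - c * ∫ s in (0 : ℝ)..t, (t - s) ^ (α - 1) * mittagLefflerKernel α (-c) α s := by
  have hG := (Real.Gamma_pos_of_pos hα).ne'
  rw [integral_rpow_mul_mittagLefflerKernel hα hα hα (-c) ht,
    mittagLefflerKernel_eq_add hα hα (-c) ht]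
  field_simp
  ring

lemma integral_sub_rpow {α a b : ℝ} (hα : 0 < α) :
    ∫ s in a..b, (b - s) ^ (α - 1) = (b - a) ^ α / α := by
  rw [intervalIntegral.integral_comp_sub_left (fun s => s ^ (α - 1)) b, sub_self,
    integral_rpow (Or.inl (by linarith)), sub_add_cancel, Real.zero_rpow hα.ne', sub_zero]

lemma intervalIntegrable_sub_rpow {α : ℝ} (hα : 0 < α) (a b t : ℝ) :
    IntervalIntegrable (fun s => (t - s) ^ (α - 1)) volume a b := by
  have h := (intervalIntegral.intervalIntegrable_rpow' (a := t - a) (b := t - b)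
    (by linarith : -1 < α - 1)).comp_sub_left t
  simpa using h

/-- If the resolvent of `c t ^ (α - 1)` is positive on `(0, t₀)`, it is positive at `t₀`. -/
lemma mittagLefflerKernel_pos_of_forall_lt {α c t₀ : ℝ} (hα : 0 < α) (hα1 : α ≤ 1) (hc : 0 ≤ c)
    (ht₀ : 0 < t₀) (hpos : ∀ t ∈ Ioo 0 t₀, 0 < mittagLefflerKernel α (-c) α t) :
    0 < mittagLefflerKernel α (-c) α t₀ := by
  by_contra hneg
  rw [not_lt] at hneg
  set e := mittagLefflerKernel α (-c) α with he
  have hG := Real.Gamma_pos_of_pos hα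
  -- The right side tends to `0` as `δ` increases to `t₀`, which is the contradiction. To prove the
  -- bound, compare the Volterra equations at `t₀` and at a maximum point `t₁` of `e` on `[δ, t₀]`;
  -- there `e t₁ > 0` can be cancelled.
  have hbound : ∀ δ ∈ Ioo 0 t₀,
      Real.Gamma α * t₀ ^ (α - 1) ≤ c * δ ^ (α - 1) * ((t₀ - δ) ^ α / α) := by
    intro δ hδ
    obtain ⟨t₁, ht₁, hmax⟩ := isCompact_Icc.exists_isMaxOn (nonempty_Icc.mpr hδ.2.le)
      ((continuousOn_mittagLefflerKernel hα hα (-c)).mono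
        (fun x hx => mem_Ioi.mpr (hδ.1.trans_le hx.1)))
    rw [← he] at hmax
    have het₁ : 0 < e t₁ := (hpos δ hδ).trans_le (hmax ⟨le_rfl, hδ.2.le⟩)
    have ht₁0 : 0 < t₁ := hδ.1.trans_le ht₁.1
    have ht₁₀ : t₁ < t₀ := lt_of_le_of_ne ht₁.2 fun h => by rw [h] at het₁; linarith
    have hA := Gamma_mul_mittagLefflerKernel_self hα c ht₁0
    have hB := Gamma_mul_mittagLefflerKernel_self hα c ht₀
    rw [← he] at hA hB
    have hi₀ := intervalIntegrable_rpow_mul_mittagLefflerKernel hα hα hα (-c) ht₀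
    have hi₁ := intervalIntegrable_rpow_mul_mittagLefflerKernel hα hα hα (-c) ht₁0
    rw [← he] at hi₀ hi₁
    have hl := hi₀.mono_set (c := 0) (d := t₁) (by
      rw [uIcc_of_le ht₁0.le, uIcc_of_le ht₀.le]; exact Icc_subset_Icc_right ht₁₀.le)
    have hr := hi₀.mono_set (c := t₁) (d := t₀) (by
      rw [uIcc_of_le ht₁₀.le, uIcc_of_le ht₀.le]; exact Icc_subset_Icc_left ht₁0.le)
    rw [← intervalIntegral.integral_add_adjacent_intervals hl hr] at hB
    have hk₁ : 0 < t₁ ^ (α - 1) := Real.rpow_pos_of_pos ht₁0 _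
    have hk₀ : 0 < t₀ ^ (α - 1) := Real.rpow_pos_of_pos ht₀ _
    have hC : (∫ s in (0 : ℝ)..t₁, (t₀ - s) ^ (α - 1) * e s) * t₁ ^ (α - 1)
        ≤ t₀ ^ (α - 1) * ∫ s in (0 : ℝ)..t₁, (t₁ - s) ^ (α - 1) * e s := by
      rw [← intervalIntegral.integral_mul_const, ← intervalIntegral.integral_const_mul]
      refine intervalIntegral.integral_mono_on_of_le_Ioo ht₁0.le (hl.mul_const _)
        (hi₁.const_mul _) fun s hs => ?_
      have hs0 := hs.1
      have hs1 := hs.2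
      -- Here `(t₀ - s) t₁ ≥ t₀ (t₁ - s)` and the exponent is nonpositive; this controls the history
      -- before `t₁`.
      have h1 : ((t₀ - s) * t₁) ^ (α - 1) ≤ (t₀ * (t₁ - s)) ^ (α - 1) :=
        Real.rpow_le_rpow_of_nonpos (mul_pos ht₀ (by linarith)) (by nlinarith) (by linarith)
      rw [Real.mul_rpow (by linarith) ht₁0.le, Real.mul_rpow ht₀.le (by linarith)] at h1
      nlinarith [hpos s ⟨hs0, hs1.trans ht₁₀⟩]
    have hD : ∫ s in t₁..t₀, (t₀ - s) ^ (α - 1) * e s ≤ e t₁ * ((t₀ - t₁) ^ α / α) := by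
      rw [← integral_sub_rpow hα, ← intervalIntegral.integral_const_mul]
      refine intervalIntegral.integral_mono_on ht₁₀.le hr
        ((intervalIntegrable_sub_rpow hα _ _ _).const_mul _) fun s hs => ?_
      rw [mul_comm]
      have h1 : e s ≤ e t₁ := hmax ⟨ht₁.1.trans hs.1, hs.2⟩
      have h2 : 0 ≤ t₀ - s := by linarith [hs.2]
      gcongr
    set I₁ := ∫ s in (0 : ℝ)..t₁, (t₁ - s) ^ (α - 1) * e s
    set J₁ := ∫ s in (0 : ℝ)..t₁, (t₀ - s) ^ (α - 1) * e s
    set J₂ := ∫ s in t₁..t₀, (t₀ - s) ^ (α - 1) * e s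
    have h1 : t₀ ^ (α - 1) ≤ c * (J₁ + J₂) := by nlinarith
    have h2 : t₀ ^ (α - 1) * t₁ ^ (α - 1) ≤ c * (J₁ + J₂) * t₁ ^ (α - 1) := by gcongr
    have h3 : c * (J₁ * t₁ ^ (α - 1)) ≤ c * (t₀ ^ (α - 1) * I₁) := by gcongr
    have h4 : c * t₁ ^ (α - 1) * J₂ ≤ c * t₁ ^ (α - 1) * (e t₁ * ((t₀ - t₁) ^ α / α)) := by gcongr
    have h5 : e t₁ * (Real.Gamma α * t₀ ^ (α - 1))
        ≤ e t₁ * (c * t₁ ^ (α - 1) * ((t₀ - t₁) ^ α / α)) := by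
      have h6 : c * I₁ = t₁ ^ (α - 1) - Real.Gamma α * e t₁ := by linarith
      have h7 : c * (t₀ ^ (α - 1) * I₁)
          = t₀ ^ (α - 1) * (t₁ ^ (α - 1) - Real.Gamma α * e t₁) := by rw [← h6]; ring
      linarith
    have h8 := le_of_mul_le_mul_left h5 het₁
    refine h8.trans ?_
    have h9 : t₁ ^ (α - 1) ≤ δ ^ (α - 1) :=
      Real.rpow_le_rpow_of_nonpos hδ.1 ht₁.1 (by linarith)
    have h10 : 0 ≤ t₀ - t₁ := by linarith
    have h11 : 0 ≤ t₀ - δ := by linarith [hδ.2]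
    have h12 := ht₁.1
    have h13 : 0 < δ ^ (α - 1) := Real.rpow_pos_of_pos hδ.1 _
    gcongr
  have hcont : ContinuousAt (fun δ : ℝ => c * δ ^ (α - 1) * ((t₀ - δ) ^ α / α)) t₀ := by
    have h1 : ContinuousAt (fun δ : ℝ => δ ^ (α - 1)) t₀ :=
      Real.continuousAt_rpow_const _ _ (Or.inl ht₀.ne')
    have h2 : ContinuousAt (fun δ : ℝ => (t₀ - δ) ^ α) t₀ :=
      ((Real.continuous_rpow_const hα.le).comp (continuous_const.sub continuous_id)).continuousAt
    exact (continuousAt_const.mul h1).mul (h2.div_const α)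
  have hlim := hcont.tendsto.mono_left (nhdsWithin_le_nhds (s := Iio t₀))
  have hle := ge_of_tendsto hlim (by
    filter_upwards [Ioo_mem_nhdsLT ht₀] with δ hδ using hbound δ hδ)
  rw [sub_self, Real.zero_rpow hα.ne', zero_div, mul_zero] at hle
  have := mul_pos hG (Real.rpow_pos_of_pos ht₀ (α - 1))
  linarith

theorem mittagLefflerKernel_pos {α c t : ℝ} (hα : 0 < α) (hα1 : α ≤ 1) (hc : 0 ≤ c)
    (ht : 0 < t) : 0 < mittagLefflerKernel α (-c) α t := by
  by_contra hneg
  -- The kernel may be singular at `0`. Removing the positive factor `t ^ (α - 1)` leaves a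
  -- continuous function, positive at `0`, for which a first nonpositive point exists.
  set q : ℝ → ℝ := fun t => mittagLeffler α α (-c * t ^ α) with hq
  have hqc : Continuous q := continuous_mittagLeffler_mul_rpow hα hα (-c)
  have hq0 : 0 < q 0 := by
    simp only [hq, Real.zero_rpow hα.ne', mul_zero, mittagLeffler_zero]
    exact one_div_pos.mpr (Real.Gamma_pos_of_pos hα)
  have hiff : ∀ s, 0 < s → (0 < mittagLefflerKernel α (-c) α s ↔ 0 < q s) := fun s hs =>
    mul_pos_iff_of_pos_left (Real.rpow_pos_of_pos hs _)
  obtain ⟨t₀, ht₀, hleast⟩ := (isCompact_Icc.inter_right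
    (isClosed_le hqc continuous_const) : IsCompact (Icc 0 t ∩ {s | q s ≤ 0})).exists_isLeast
    ⟨t, ⟨ht.le, le_rfl⟩, not_lt.mp (fun h => hneg ((hiff t ht).mpr h))⟩
  have ht₀q : q t₀ ≤ 0 := ht₀.2
  have ht₀0 : 0 < t₀ := lt_of_le_of_ne ht₀.1.1 fun h => by rw [← h] at ht₀q; linarith
  refine absurd ((hiff t₀ ht₀0).mp (mittagLefflerKernel_pos_of_forall_lt hα hα1 hc ht₀0
    fun s hs => (hiff s hs.1).mpr ?_)) (not_lt.mpr ht₀q)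
  by_contra h
  exact absurd (hleast ⟨⟨hs.1.le, hs.2.le.trans ht₀.1.2⟩, not_lt.mp h⟩) (not_le.mpr hs.2)

lemma integral_mittagLefflerKernel_sub_mul_rpow {α β γ : ℝ} (hα : 0 < α) (hβ : 0 < β)
    (hγ : 0 < γ) (lam : ℝ) {t : ℝ} (ht : 0 < t) :
    ∫ s in (0 : ℝ)..t, mittagLefflerKernel α lam β (t - s) * s ^ (γ - 1)
      = Real.Gamma γ * mittagLefflerKernel α lam (β + γ) t := by
  rw [← integral_rpow_mul_mittagLefflerKernel hα hβ hγ lam ht]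
  have h := intervalIntegral.integral_comp_sub_left (a := 0) (b := t)
    (fun s => (t - s) ^ (γ - 1) * mittagLefflerKernel α lam β s) t
  rw [sub_self, sub_zero] at h
  rw [← h]
  refine intervalIntegral.integral_congr fun s _ => ?_
  simp only [sub_sub_cancel]
  ring

lemma intervalIntegrable_mittagLefflerKernel_sub_mul_rpow {α β γ : ℝ} (hα : 0 < α) (hβ : 0 < β)
    (hγ : 0 < γ) (lam : ℝ) {t : ℝ} (ht : 0 < t) :
    IntervalIntegrable (fun s => mittagLefflerKernel α lam β (t - s) * s ^ (γ - 1))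
      volume 0 t := by
  have h := ((intervalIntegrable_rpow_mul_mittagLefflerKernel hα hβ hγ lam ht).comp_sub_left t).symm
  rw [sub_self, sub_zero] at h
  refine h.congr fun s _ => ?_
  simp only [sub_sub_cancel]
  ring

lemma mittagLefflerKernel_one {α lam t : ℝ} :
    mittagLefflerKernel α lam 1 t = mittagLeffler α 1 (lam * t ^ α) := by
  simp [mittagLefflerKernel]

lemma mittagLefflerKernel_add_one {α β : ℝ} (hα : 0 < α) (hβ : 0 < β) (lam : ℝ) {t : ℝ}
    (ht : 0 < t) :
    mittagLefflerKernel α lam (β + 1) t = ∫ s in (0 : ℝ)..t, mittagLefflerKernel α lam β s := by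
  have h := integral_rpow_mul_mittagLefflerKernel hα hβ one_pos lam ht
  simpa using h.symm

lemma intervalIntegrable_mittagLefflerKernel {α β : ℝ} (hα : 0 < α) (hβ : 0 < β) (lam : ℝ)
    {t : ℝ} (ht : 0 < t) :
    IntervalIntegrable (mittagLefflerKernel α lam β) volume 0 t := by
  simpa using intervalIntegrable_rpow_mul_mittagLefflerKernel hα hβ one_pos lam ht

/-- This transfers sign and monotonicity between `E` and `F`, and produces the cancellation in the
variation of constants. -/
lemma mittagLefflerKernel_one_eq {α : ℝ} (hα : 0 < α) (c : ℝ) {t : ℝ} (ht : 0 < t) :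
    mittagLefflerKernel α (-c) 1 t = 1 - c * mittagLefflerKernel α (-c) (α + 1) t := by
  rw [mittagLefflerKernel_eq_add hα one_pos (-c) ht, add_comm 1 α]
  simp
  ring

/-- Up to a positive factor, `E` is the fractional integral of order `1 - α` of the positive `e`. -/
lemma mittagLefflerKernel_one_nonneg {α c t : ℝ} (hα : 0 < α) (hα1 : α < 1) (hc : 0 ≤ c)
    (ht : 0 < t) : 0 ≤ mittagLefflerKernel α (-c) 1 t := by
  have h := integral_rpow_mul_mittagLefflerKernel hα hα (sub_pos.mpr hα1) (-c) ht
  rw [add_sub_cancel] at h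
  have hG := Real.Gamma_pos_of_pos (sub_pos.mpr hα1)
  refine nonneg_of_mul_nonneg_right (b := mittagLefflerKernel α (-c) 1 t) ?_ hG
  rw [← h, intervalIntegral.integral_of_le ht.le]
  refine setIntegral_nonneg measurableSet_Ioc fun s hs => ?_
  have h1 : 0 ≤ t - s := by linarith [hs.2]
  have h2 := mittagLefflerKernel_pos hα hα1.le hc hs.1
  positivity

lemma mittagLefflerKernel_add_one_mono {α c s t : ℝ} (hα : 0 < α) (hα1 : α ≤ 1) (hc : 0 ≤ c)
    (hs : 0 < s) (hst : s ≤ t) :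
    mittagLefflerKernel α (-c) (α + 1) s ≤ mittagLefflerKernel α (-c) (α + 1) t := by
  have ht := hs.trans_le hst
  rw [mittagLefflerKernel_add_one hα hα _ hs, mittagLefflerKernel_add_one hα hα _ ht]
  refine intervalIntegral.integral_mono_interval le_rfl hs.le hst ?_
    (intervalIntegrable_mittagLefflerKernel hα hα _ ht)
  exact (ae_restrict_iff' measurableSet_Ioc).mpr
    (Filter.Eventually.of_forall fun r hr => (mittagLefflerKernel_pos hα hα1 hc hr.1).le)

lemma mittagLefflerKernel_add_one_nonneg {α c t : ℝ} (hα : 0 < α) (hα1 : α ≤ 1) (hc : 0 ≤ c)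
    (ht : 0 < t) : 0 ≤ mittagLefflerKernel α (-c) (α + 1) t := by
  rw [mittagLefflerKernel_add_one hα hα _ ht, intervalIntegral.integral_of_le ht.le]
  exact setIntegral_nonneg measurableSet_Ioc fun r hr => (mittagLefflerKernel_pos hα hα1 hc hr.1).le

/-- Since `E` decreases, its fractional integral `Γ(α) F t` of order `α` is at least `(t ^ α / α) E
t`, while `c F = 1 - E ≤ 1`. -/
lemma mittagLefflerKernel_one_le {α c t : ℝ} (hα : 0 < α) (hα1 : α < 1) (hc : 0 < c)
    (ht : 0 < t) :
    mittagLefflerKernel α (-c) 1 t ≤ Real.Gamma (1 + α) / c * t ^ (-α) := by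
  have hG := Real.Gamma_pos_of_pos hα
  have hE := mittagLefflerKernel_one_nonneg hα hα1 hc.le ht
  have h1 := integral_rpow_mul_mittagLefflerKernel hα one_pos hα (-c) ht
  have h2 : (t ^ α / α) * mittagLefflerKernel α (-c) 1 t
      ≤ ∫ s in (0 : ℝ)..t, (t - s) ^ (α - 1) * mittagLefflerKernel α (-c) 1 s := by
    have h3 := integral_sub_rpow (a := 0) (b := t) hα
    rw [sub_zero] at h3
    rw [← h3, ← intervalIntegral.integral_mul_const]
    refine intervalIntegral.integral_mono_on_of_le_Ioo ht.le
      ((intervalIntegrable_sub_rpow hα _ _ _).mul_const _)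
      (intervalIntegrable_rpow_mul_mittagLefflerKernel hα one_pos hα (-c) ht) fun s hs => ?_
    have h4 : 0 ≤ t - s := by linarith [hs.2]
    rw [mittagLefflerKernel_one_eq hα c ht, mittagLefflerKernel_one_eq hα c hs.1]
    have := mittagLefflerKernel_add_one_mono hα hα1.le hc.le hs.1 hs.2.le
    gcongr
  rw [h1, add_comm 1 α] at h2
  have h5 := mittagLefflerKernel_one_eq hα c ht
  set E := mittagLefflerKernel α (-c) 1 t
  set F := mittagLefflerKernel α (-c) (α + 1) t
  have htα := Real.rpow_pos_of_pos ht α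
  have h6 : t ^ α * E ≤ α * Real.Gamma α * F := by
    rw [div_mul_eq_mul_div, div_le_iff₀ hα] at h2
    linarith
  rw [add_comm 1 α, Real.Gamma_add_one hα.ne', Real.rpow_neg ht.le, ← div_eq_mul_inv, div_div,
    le_div_iff₀ (by positivity)]
  have h7 : c * (t ^ α * E) ≤ c * (α * Real.Gamma α * F) := by gcongr
  have h8 : α * Real.Gamma α * (c * F) = α * Real.Gamma α * (1 - E) := by rw [h5]; ring
  have h9 : 0 ≤ α * Real.Gamma α * E := by positivity
  linarith

/-! ### Representation of `η` through the resolvent kernel -/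

/-- Associativity of the convolution `A * (B * g) = (A * B) * g` on `(0, t)`, pointwise at `t`, for
nonnegative `A` and `B` whose convolution `D` is bounded. -/
theorem integral_mul_convolution_eq {A B D g : ℝ → ℝ} {t M : ℝ} (ht : 0 < t) (hA : Measurable A)
    (hB : Measurable B) (hA0 : ∀ s, 0 < s → 0 ≤ A s) (hB0 : ∀ s, 0 < s → 0 ≤ B s)
    (hg : IntervalIntegrable g volume 0 t)
    (hint : ∀ τ ∈ Ioc 0 t, IntervalIntegrable (fun s => A (τ - s) * B s) volume 0 τ)
    (hD : ∀ τ ∈ Ioc 0 t, ∫ s in (0 : ℝ)..τ, A (τ - s) * B s = D τ)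
    (hM : ∀ τ ∈ Ioc 0 t, D τ ≤ M) :
    IntervalIntegrable (fun s => A (t - s) * ∫ r in (0 : ℝ)..s, B (s - r) * g r) volume 0 t ∧
      ∫ s in (0 : ℝ)..t, A (t - s) * ∫ r in (0 : ℝ)..s, B (s - r) * g r
        = ∫ r in (0 : ℝ)..t, D (t - r) * g r := by
  set μ := volume.restrict (Ioo 0 t) with hμ
  have hgμ : Integrable g μ := (intervalIntegrable_iff_integrableOn_Ioo_of_le ht.le).mp hg
  -- Extending by zero off the triangle `r < s` turns the iterated integral into one over a square,
  -- ready for Fubini.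
  set K : ℝ → ℝ → ℝ := fun r => (Ioi r).indicator fun s => A (t - s) * B (s - r) with hK
  set H : ℝ × ℝ → ℝ := fun z => K z.2 z.1 * g z.2 with hH
  have hKm : Measurable fun z : ℝ × ℝ => K z.2 z.1 := by
    have h : (fun z : ℝ × ℝ => K z.2 z.1)
        = {z : ℝ × ℝ | z.2 < z.1}.indicator fun z => A (t - z.1) * B (z.1 - z.2) := by
      ext z
      simp [hK, indicator]
    rw [h]
    refine Measurable.indicator ?_ (measurableSet_lt measurable_snd measurable_fst)
    fun_prop
  have hHm : AEStronglyMeasurable H (μ.prod μ) :=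
    hKm.aestronglyMeasurable.mul hgμ.aestronglyMeasurable.comp_snd
  have hset : ∀ r ∈ Ioo 0 t, Ioi r ∩ Ioo 0 t = Ioo r t := fun r hr => by
    ext s
    simp only [mem_inter_iff, mem_Ioi, mem_Ioo]
    exact ⟨fun h => ⟨h.1, h.2.2⟩, fun h => ⟨h.1, hr.1.trans h.1, h.2⟩⟩
  have hKi : ∀ r ∈ Ioo 0 t, Integrable (K r) μ := by
    intro r hr
    have h := (hint (t - r) ⟨by linarith [hr.2], by linarith [hr.1]⟩).comp_sub_right r
    simp only [sub_sub_sub_cancel_right, zero_add, sub_add_cancel] at h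
    rw [intervalIntegrable_iff_integrableOn_Ioo_of_le hr.2.le] at h
    rw [hK, integrable_indicator_iff measurableSet_Ioi, IntegrableOn, hμ,
      Measure.restrict_restrict measurableSet_Ioi, hset r hr]
    exact h
  have hKv : ∀ r ∈ Ioo 0 t, ∫ s, K r s ∂μ = D (t - r) := by
    intro r hr
    have h := intervalIntegral.integral_comp_sub_right (a := r) (b := t)
      (fun s => A (t - r - s) * B s) r
    rw [sub_self, hD (t - r) ⟨by linarith [hr.2], by linarith [hr.1]⟩] at h
    simp only [sub_sub_sub_cancel_right] at h
    rw [hK, integral_indicator measurableSet_Ioi, hμ,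
      Measure.restrict_restrict measurableSet_Ioi, hset r hr, ← integral_Ioc_eq_integral_Ioo,
      ← intervalIntegral.integral_of_le hr.2.le, h]
  have hK0 : ∀ r, ∀ s ∈ Ioo 0 t, 0 ≤ K r s := fun r s hs =>
    indicator_apply_nonneg fun hrs => mul_nonneg (hA0 _ (sub_pos.mpr hs.2)) (hB0 _ (sub_pos.mpr hrs))
  have hnorm : ∀ r ∈ Ioo 0 t, ∫ s, ‖H (s, r)‖ ∂μ = D (t - r) * ‖g r‖ := by
    intro r hr
    rw [← hKv r hr, ← integral_mul_const]
    refine setIntegral_congr_fun measurableSet_Ioo fun s hs => ?_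
    simp only [hH, norm_mul, Real.norm_of_nonneg (hK0 r s hs)]
  have hD0 : ∀ r ∈ Ioo 0 t, 0 ≤ D (t - r) := fun r hr => by
    rw [← hKv r hr]
    exact setIntegral_nonneg measurableSet_Ioo fun s hs => hK0 r s hs
  -- Nonnegativity of `A` and `B` makes the inner integral of `‖H‖` equal to `D (t - r) * ‖g r‖`,
  -- which `M * ‖g r‖` dominates.
  have hHi : Integrable H (μ.prod μ) := by
    rw [integrable_prod_iff' hHm]
    refine ⟨(ae_restrict_iff' measurableSet_Ioo).mpr (Filter.Eventually.of_forall fun r hr =>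
      (hKi r hr).mul_const (g r)), ?_⟩
    refine (hgμ.norm.const_mul M).mono' hHm.norm.prod_swap.integral_prod_right'
      ((ae_restrict_iff' measurableSet_Ioo).mpr (Filter.Eventually.of_forall fun r hr => ?_))
    rw [hnorm r hr, Real.norm_of_nonneg (mul_nonneg (hD0 r hr) (norm_nonneg _))]
    exact mul_le_mul_of_nonneg_right (hM _ ⟨by linarith [hr.2], by linarith [hr.1]⟩)
      (norm_nonneg _)
  have hin : ∀ s ∈ Ioo 0 t, ∫ r, H (s, r) ∂μ = A (t - s) * ∫ r in (0 : ℝ)..s, B (s - r) * g r := by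
    intro s hs
    have h : (fun r => H (s, r)) = (Iio s).indicator fun r => A (t - s) * (B (s - r) * g r) := by
      ext r
      by_cases hrs : r < s
      · simp only [hH, hK, indicator, mem_Ioi, mem_Iio, hrs, if_true]
        ring
      · simp [hH, hK, indicator, hrs]
    have hs' : Iio s ∩ Ioo 0 t = Ioo 0 s := by
      ext r
      simp only [mem_inter_iff, mem_Iio, mem_Ioo]
      exact ⟨fun h => ⟨h.2.1, h.1⟩, fun h => ⟨h.2, h.1, h.2.trans hs.2⟩⟩
    rw [h, integral_indicator measurableSet_Iio, hμ, Measure.restrict_restrict measurableSet_Iio,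
      hs', integral_const_mul, ← integral_Ioc_eq_integral_Ioo,
      ← intervalIntegral.integral_of_le hs.1.le]
  constructor
  · rw [intervalIntegrable_iff_integrableOn_Ioo_of_le ht.le]
    exact IntegrableOn.congr_fun hHi.integral_prod_left hin measurableSet_Ioo
  · rw [intervalIntegral.integral_of_le ht.le, intervalIntegral.integral_of_le ht.le,
      integral_Ioc_eq_integral_Ioo, integral_Ioc_eq_integral_Ioo,
      ← setIntegral_congr_fun measurableSet_Ioo hin, ← integral_prod _ hHi, integral_prod_symm _ hHi]
    refine setIntegral_congr_fun measurableSet_Ioo fun r hr => ?_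
    simp only [hH]
    rw [integral_mul_const, hKv r hr]

lemma measurable_mittagLefflerKernel {α β : ℝ} (hα : 0 < α) (hβ : 0 < β) (lam : ℝ) :
    Measurable (mittagLefflerKernel α lam β) :=
  (measurable_id.pow_const _).mul (continuous_mittagLeffler_mul_rpow hα hβ lam).measurable

lemma continuous_mittagLefflerKernel_one {α : ℝ} (hα : 0 < α) (lam : ℝ) :
    Continuous (mittagLefflerKernel α lam 1) := by
  have h : mittagLefflerKernel α lam 1 = fun t => mittagLeffler α 1 (lam * t ^ α) :=
    funext fun t => mittagLefflerKernel_one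
  rw [h]
  exact continuous_mittagLeffler_mul_rpow hα one_pos lam

lemma mittagLefflerKernel_one_zero {α : ℝ} (hα : 0 < α) (lam : ℝ) :
    mittagLefflerKernel α lam 1 0 = 1 := by
  simp [mittagLefflerKernel_one, Real.zero_rpow hα.ne', mittagLeffler_zero]

/-- Convolving the resolvent kernel with the Caputo derivative. -/
lemma integral_mittagLefflerKernel_mul_caputoDeriv {α c t : ℝ} {η : ℝ → ℝ} (hα : 0 < α)
    (hα1 : α ≤ 1) (hc : 0 ≤ c) (ht : 0 < t) (hη : IntervalIntegrable (deriv η) volume 0 t) :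
    IntervalIntegrable (fun s => mittagLefflerKernel α (-c) α (t - s) * caputoDeriv α η s)
        volume 0 t ∧
      ∫ s in (0 : ℝ)..t, mittagLefflerKernel α (-c) α (t - s) * caputoDeriv α η s
        = ∫ s in (0 : ℝ)..t, mittagLefflerKernel α (-c) 1 (t - s) * deriv η s := by
  -- At `α = 1` the kernels `e` and `E` coincide and nothing has to be convolved.
  rcases hα1.eq_or_lt with rfl | hα1
  · simp only [caputoDeriv, if_true, and_true]
    exact hη.continuousOn_mul ((continuous_mittagLefflerKernel_one hα (-c)).comp
      (continuous_const.sub continuous_id)).continuousOn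
  have hG := Real.Gamma_pos_of_pos (sub_pos.mpr hα1)
  have hγ := sub_pos.mpr hα1
  simp only [caputoDeriv, hα1.ne, if_false]
  refine integral_mul_convolution_eq (B := fun s => 1 / Real.Gamma (1 - α) * s ^ (-α)) (M := 1) ht
    (measurable_mittagLefflerKernel hα hα (-c)) ?_
    (fun s hs => (mittagLefflerKernel_pos hα hα1.le hc hs).le) (fun s hs => by positivity) hη
    (fun τ hτ => ?_) (fun τ hτ => ?_) fun τ hτ => ?_
  · exact measurable_const.mul (measurable_id.pow_const _)
  · have h := (intervalIntegrable_mittagLefflerKernel_sub_mul_rpow hα hα hγ (-c) hτ.1).const_mul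
      (1 / Real.Gamma (1 - α))
    rw [sub_sub_cancel_left] at h
    exact h.congr fun s _ => by ring
  · have h := integral_mittagLefflerKernel_sub_mul_rpow hα hα hγ (-c) hτ.1
    rw [sub_sub_cancel_left, add_sub_cancel] at h
    rw [eq_comm, ← mul_right_inj' hG.ne', ← h, ← intervalIntegral.integral_const_mul]
    refine intervalIntegral.integral_congr fun s _ => ?_
    field_simp
  · rw [mittagLefflerKernel_one_eq hα c hτ.1]
    have := mul_nonneg hc (mittagLefflerKernel_add_one_nonneg hα hα1.le hc hτ.1)
    linarith

/-- Variation of constants for the Caputo derivative. -/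
theorem integral_mittagLefflerKernel_mul_relaxation {α c t : ℝ} {η : ℝ → ℝ} (hα : 0 < α)
    (hα1 : α ≤ 1) (hc : 0 ≤ c) (ht : 0 < t) (hη : IntervalIntegrable (deriv η) volume 0 t)
    (hftc : ∀ s ∈ Icc 0 t, ∫ r in (0 : ℝ)..s, deriv η r = η s - η 0) :
    IntervalIntegrable
        (fun s => mittagLefflerKernel α (-c) α (t - s) * (caputoDeriv α η s + c * η s))
        volume 0 t ∧
      ∫ s in (0 : ℝ)..t, mittagLefflerKernel α (-c) α (t - s) * (caputoDeriv α η s + c * η s)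
        = η t - mittagLefflerKernel α (-c) 1 t * η 0 := by
  obtain ⟨h1i, h1⟩ := integral_mittagLefflerKernel_mul_caputoDeriv hα hα1 hc ht hη
  have hei : ∀ τ, 0 < τ → IntervalIntegrable (fun s => mittagLefflerKernel α (-c) α (τ - s))
      volume 0 τ := fun τ hτ => by
    have h := intervalIntegrable_mittagLefflerKernel_sub_mul_rpow hα hα one_pos (-c) hτ
    simpa using h
  have he : ∀ τ, 0 < τ → ∫ s in (0 : ℝ)..τ, mittagLefflerKernel α (-c) α (τ - s)
      = mittagLefflerKernel α (-c) (α + 1) τ := fun τ hτ => by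
    have h := integral_mittagLefflerKernel_sub_mul_rpow hα hα one_pos (-c) hτ
    simpa using h
  obtain ⟨h2i, h2⟩ := integral_mul_convolution_eq (A := mittagLefflerKernel α (-c) α)
    (B := fun _ => 1) (D := mittagLefflerKernel α (-c) (α + 1))
    (M := mittagLefflerKernel α (-c) (α + 1) t) ht
    (measurable_mittagLefflerKernel hα hα (-c)) measurable_const
    (fun s hs => (mittagLefflerKernel_pos hα hα1 hc hs).le) (fun s hs => zero_le_one) hη
    (fun τ hτ => by simpa using hei τ hτ.1) (fun τ hτ => by simpa using he τ hτ.1)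
    (fun τ hτ => mittagLefflerKernel_add_one_mono hα hα1 hc hτ.1 hτ.2)
  simp only [one_mul] at h2i h2
  have h3i := (hei t ht).mul_const (η 0)
  have h3 : ∫ s in (0 : ℝ)..t, mittagLefflerKernel α (-c) α (t - s) * η 0
      = mittagLefflerKernel α (-c) (α + 1) t * η 0 := by
    rw [intervalIntegral.integral_mul_const, he t ht]
  have hsum : ∀ s ∈ uIcc 0 t,
      mittagLefflerKernel α (-c) α (t - s) * caputoDeriv α η s
        + c * (mittagLefflerKernel α (-c) α (t - s) * (∫ r in (0 : ℝ)..s, deriv η r)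
          + mittagLefflerKernel α (-c) α (t - s) * η 0)
      = mittagLefflerKernel α (-c) α (t - s) * (caputoDeriv α η s + c * η s) := fun s hs => by
    rw [uIcc_of_le ht.le] at hs
    rw [hftc s hs]
    ring
  have hi := h1i.add ((h2i.add h3i).const_mul c)
  refine ⟨hi.congr fun s hs => hsum s (uIoc_subset_uIcc hs), ?_⟩
  rw [← intervalIntegral.integral_congr hsum,
    intervalIntegral.integral_add h1i ((h2i.add h3i).const_mul c),
    intervalIntegral.integral_const_mul, intervalIntegral.integral_add h2i h3i, h1, h2, h3]
  have hEi : IntervalIntegrable (fun s => mittagLefflerKernel α (-c) 1 (t - s) * deriv η s)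
      volume 0 t := hη.continuousOn_mul ((continuous_mittagLefflerKernel_one hα (-c)).comp
      (continuous_const.sub continuous_id)).continuousOn
  -- Substituting `c F = 1 - E` yields `η t - η 0` and a term cancelling the convolution of `E` with
  -- `deriv η` from the Caputo part.
  have h4 : c * ∫ s in (0 : ℝ)..t, mittagLefflerKernel α (-c) (α + 1) (t - s) * deriv η s
      = (∫ s in (0 : ℝ)..t, deriv η s)
        - ∫ s in (0 : ℝ)..t, mittagLefflerKernel α (-c) 1 (t - s) * deriv η s := by
    rw [← intervalIntegral.integral_sub hη hEi, ← intervalIntegral.integral_const_mul,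
      intervalIntegral.integral_of_le ht.le, intervalIntegral.integral_of_le ht.le,
      integral_Ioc_eq_integral_Ioo, integral_Ioc_eq_integral_Ioo]
    refine setIntegral_congr_fun measurableSet_Ioo fun s hs => ?_
    rw [mittagLefflerKernel_one_eq hα c (sub_pos.mpr hs.2)]
    ring
  rw [hftc t ⟨ht.le, le_rfl⟩] at h4
  rw [mul_add, h4, mittagLefflerKernel_one_eq hα c ht]
  ring

/-- The comparison principle. -/
theorem RelaxationInequality.le_relaxationSolution {α c T : ℝ} {η φ : ℝ → ℝ} (hα : 0 < α)
    (hα1 : α ≤ 1) (hc : 0 ≤ c) (hT : 0 < T) (hW : MemSobolevW1 1 0 T η)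
    (hη : ContinuousOn η (Icc 0 T)) (h : RelaxationInequality α c T η φ) {t : ℝ}
    (ht : t ∈ Ioc 0 T) (hφ : IntervalIntegrable (relaxationIntegrand α c φ t) volume 0 t) :
    η t ≤ relaxationSolution α c (η 0) φ t := by
  obtain ⟨hi, hftc⟩ := hW.integral_deriv_eq_sub hT hη
  obtain ⟨hrep_i, hrep⟩ := integral_mittagLefflerKernel_mul_relaxation hα hα1 hc ht.1
    (hi.mono_set (by
      rw [uIcc_of_le ht.1.le, uIcc_of_le hT.le]; exact Icc_subset_Icc_right ht.2))
    (fun s hs => hftc s ⟨hs.1, hs.2.trans ht.2⟩)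
  have hmono : ∫ s in (0 : ℝ)..t,
      mittagLefflerKernel α (-c) α (t - s) * (caputoDeriv α η s + c * η s)
      ≤ ∫ s in (0 : ℝ)..t, relaxationIntegrand α c φ t s := by
    rw [intervalIntegral.integral_of_le ht.1.le, intervalIntegral.integral_of_le ht.1.le,
      integral_Ioc_eq_integral_Ioo, integral_Ioc_eq_integral_Ioo]
    refine setIntegral_mono_on_ae
      ((intervalIntegrable_iff_integrableOn_Ioo_of_le ht.1.le).mp hrep_i)
      ((intervalIntegrable_iff_integrableOn_Ioo_of_le ht.1.le).mp hφ) measurableSet_Ioo ?_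
    filter_upwards [(ae_restrict_iff' measurableSet_Ioo).mp h] with s hs hs'
    exact mul_le_mul_of_nonneg_left (hs ⟨hs'.1, hs'.2.trans_le ht.2⟩)
      (mittagLefflerKernel_pos hα hα1 hc (sub_pos.mpr hs'.2)).le
  rw [relaxationSolution, ← mittagLefflerKernel_one]
  linarith

/-! ### Special right-hand sides -/

/-- Passing to rate `0` lets the comparison principle be reused with a pure power kernel; this is
why that principle allows `c = 0`. -/
lemma RelaxationInequality.of_nonneg {α c T : ℝ} {η φ : ℝ → ℝ} (hc : 0 ≤ c)
    (h : RelaxationInequality α c T η φ) (hη : ∀ᵐ t ∂(volume.restrict (Ioo 0 T)), 0 ≤ η t) :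
    RelaxationInequality α 0 T η φ := by
  filter_upwards [h, hη] with t ht ht'
  have := mul_nonneg hc ht'
  linarith

lemma relaxationIntegrand_zero (α : ℝ) (φ : ℝ → ℝ) (t s : ℝ) :
    relaxationIntegrand α 0 φ t s = 1 / Real.Gamma α * ((t - s) ^ (α - 1) * φ s) := by
  simp only [relaxationIntegrand, neg_zero, zero_mul, mittagLeffler_zero]
  ring

theorem RelaxationInequality.le_fractionalIntegral {α c T : ℝ} {η φ : ℝ → ℝ} (hα : 0 < α)
    (hα1 : α ≤ 1) (hc : 0 ≤ c) (hT : 0 < T) (hW : MemSobolevW1 1 0 T η)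
    (hη : ContinuousOn η (Icc 0 T)) (h : RelaxationInequality α c T η φ)
    (hpos : ∀ᵐ t ∂(volume.restrict (Ioo 0 T)), 0 ≤ η t) {t : ℝ} (ht : t ∈ Ioc 0 T)
    (hφ : IntervalIntegrable (fun s => (t - s) ^ (α - 1) * φ s) volume 0 t) :
    η t ≤ η 0 + (1 / Real.Gamma α) * ∫ s in (0 : ℝ)..t, (t - s) ^ (α - 1) * φ s := by
  have h1 := (h.of_nonneg hc hpos).le_relaxationSolution hα hα1 le_rfl hT hW hη ht
    ((hφ.const_mul (1 / Real.Gamma α)).congr fun s _ => (relaxationIntegrand_zero α φ t s).symm)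
  simpa [relaxationSolution, relaxationIntegrand_zero, mittagLeffler_zero] using h1

/-- Convolving `e` with `s ^ (-α)` gives exactly `Γ(1 - α) E`, so the forcing acts as an increment
of the initial value. -/
lemma RelaxationInequality.le_of_rpow {α c T φ₀ : ℝ} {η : ℝ → ℝ} (hα : 0 < α) (hα1 : α < 1)
    (hc : 0 ≤ c) (hT : 0 < T) (hW : MemSobolevW1 1 0 T η) (hη : ContinuousOn η (Icc 0 T))
    (h : RelaxationInequality α c T η fun t => φ₀ * t ^ (-α)) {t : ℝ} (ht : t ∈ Ioc 0 T) :
    η t ≤ mittagLefflerKernel α (-c) 1 t * (η 0 + φ₀ * Real.Gamma (1 - α)) := by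
  have hγ := sub_pos.mpr hα1
  have hi := (intervalIntegrable_mittagLefflerKernel_sub_mul_rpow hα hα hγ (-c) ht.1).const_mul φ₀
  have hv := integral_mittagLefflerKernel_sub_mul_rpow hα hα hγ (-c) ht.1
  rw [sub_sub_cancel_left] at hi hv
  rw [add_sub_cancel] at hv
  have he : ∀ s, φ₀ * (mittagLefflerKernel α (-c) α (t - s) * s ^ (-α))
      = relaxationIntegrand α c (fun t => φ₀ * t ^ (-α)) t s := fun s => by
    simp only [relaxationIntegrand, mittagLefflerKernel]
    ring
  simp only [he] at hi
  have h1 := h.le_relaxationSolution hα hα1.le hc hT hW hη ht hi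
  rw [relaxationSolution, ← mittagLefflerKernel_one] at h1
  simp only [← he] at h1
  rw [intervalIntegral.integral_const_mul, hv] at h1
  linarith

/-- Let `t → 0` in `le_of_rpow`: as `E` tends to `1`, continuity gives `η 0 ≤ η 0 + φ₀ Γ(1 - α)`. -/
lemma RelaxationInequality.nonneg_of_rpow {α c T φ₀ : ℝ} {η : ℝ → ℝ} (hα : 0 < α) (hα1 : α < 1)
    (hc : 0 ≤ c) (hT : 0 < T) (hW : MemSobolevW1 1 0 T η) (hη : ContinuousOn η (Icc 0 T))
    (h : RelaxationInequality α c T η fun t => φ₀ * t ^ (-α)) : 0 ≤ φ₀ := by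
  have hG := Real.Gamma_pos_of_pos (sub_pos.mpr hα1)
  have hl : Filter.Tendsto η (nhdsWithin 0 (Ioc 0 T)) (nhds (η 0)) :=
    (hη 0 ⟨le_rfl, hT.le⟩).tendsto.mono_left (nhdsWithin_mono _ Ioc_subset_Icc_self)
  have hr := (((continuous_mittagLefflerKernel_one hα (-c)).mul_const
    (η 0 + φ₀ * Real.Gamma (1 - α))).tendsto 0).mono_left (nhdsWithin_le_nhds (s := Ioc 0 T))
  rw [mittagLefflerKernel_one_zero hα, one_mul] at hr
  have : (nhdsWithin (0 : ℝ) (Ioc 0 T)).NeBot := by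
    rw [nhdsWithin_Ioc_eq_nhdsGT hT]
    infer_instance
  have hle := le_of_tendsto_of_tendsto hl hr (by
    filter_upwards [self_mem_nhdsWithin] with t ht using h.le_of_rpow hα hα1 hc hT hW hη ht)
  refine nonneg_of_mul_nonneg_left (b := Real.Gamma (1 - α)) ?_ hG
  linarith

lemma Real.Gamma_le_one_of_mem_Icc {x : ℝ} (hx : x ∈ Icc 1 2) : Real.Gamma x ≤ 1 := by
  have h := Real.convexOn_Gamma.le_max_of_mem_Icc (x := 1) (y := 2) (by simp) (by simp) hx
  simpa using h

/-- Equivalent to `Γ(1 + α) Γ(2 - α) ≤ 1`; both arguments lie in `[1, 2]`, where convexity and `Γ(1)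
= Γ(2) = 1` bound Gamma by `1`. -/
lemma Real.Gamma_one_sub_le {α : ℝ} (hα : 0 < α) (hα1 : α < 1) :
    Real.Gamma (1 - α) ≤ 1 / (Real.Gamma α * α * (1 - α)) := by
  have hG := Real.Gamma_pos_of_pos hα
  have hγ := sub_pos.mpr hα1
  rw [le_div_iff₀ (by positivity)]
  have h1 := Real.Gamma_add_one hα.ne'
  have h2 := Real.Gamma_add_one hγ.ne'
  calc Real.Gamma (1 - α) * (Real.Gamma α * α * (1 - α))
      = Real.Gamma (α + 1) * Real.Gamma (1 - α + 1) := by rw [h1, h2]; ring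
    _ ≤ 1 * 1 := mul_le_mul (Real.Gamma_le_one_of_mem_Icc ⟨by linarith, by linarith⟩)
        (Real.Gamma_le_one_of_mem_Icc ⟨by linarith, by linarith⟩)
        (Real.Gamma_pos_of_pos (by linarith)).le zero_le_one
    _ = 1 := one_mul 1

lemma RelaxationInequality.le_rpow_of_rpow {α c T φ₀ : ℝ} {η : ℝ → ℝ} (hα : 0 < α) (hα1 : α < 1)
    (hc : 0 < c) (hT : 0 < T) (hW : MemSobolevW1 1 0 T η) (hη : ContinuousOn η (Icc 0 T))
    (h : RelaxationInequality α c T η fun t => φ₀ * t ^ (-α)) (h0 : 0 ≤ η 0) {t : ℝ}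
    (ht : t ∈ Ioc 0 T) :
    η t ≤ (Real.Gamma (1 + α) * c⁻¹ * η 0
      + φ₀ * (Real.Gamma (1 - α) * Real.Gamma (1 + α)) / c) * t ^ (-α) := by
  have hφ := h.nonneg_of_rpow hα hα1 hc.le hT hW hη
  have hG := Real.Gamma_pos_of_pos (sub_pos.mpr hα1)
  calc η t ≤ mittagLefflerKernel α (-c) 1 t * (η 0 + φ₀ * Real.Gamma (1 - α)) :=
        h.le_of_rpow hα hα1 hc.le hT hW hη ht
    _ ≤ Real.Gamma (1 + α) / c * t ^ (-α) * (η 0 + φ₀ * Real.Gamma (1 - α)) := by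
        have := mittagLefflerKernel_one_le hα hα1 hc ht.1
        gcongr
    _ = _ := by
        field_simp

lemma RelaxationInequality.le_of_rpow_of_nonneg {α c T φ₀ : ℝ} {η : ℝ → ℝ} (hα : 0 < α)
    (hα1 : α < 1) (hc : 0 ≤ c) (hT : 0 < T) (hW : MemSobolevW1 1 0 T η)
    (hη : ContinuousOn η (Icc 0 T)) (h : RelaxationInequality α c T η fun t => φ₀ * t ^ (-α))
    (hpos : ∀ᵐ t ∂(volume.restrict (Ioo 0 T)), 0 ≤ η t) {t : ℝ} (ht : t ∈ Ioc 0 T) :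
    η t ≤ η 0 + φ₀ / (Real.Gamma α * α * (1 - α)) := by
  have hφ := h.nonneg_of_rpow hα hα1 hc hT hW hη
  have h1 := (h.of_nonneg hc hpos).le_of_rpow hα hα1 le_rfl hT hW hη ht
  rw [neg_zero, mittagLefflerKernel_one, zero_mul, mittagLeffler_zero, Real.Gamma_one, div_one,
    one_mul] at h1
  have h2 := mul_le_mul_of_nonneg_left (Real.Gamma_one_sub_le hα hα1) hφ
  rw [mul_one_div] at h2
  linarith

/-- The comparison function is `E η 0 + F φ₀`; both `E ≤ 1` and `c F ≤ 1` follow from `E + c F = 1`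
with nonnegative summands. -/
lemma RelaxationInequality.le_of_const {α c T φ₀ : ℝ} {η : ℝ → ℝ} (hα : 0 < α) (hα1 : α < 1)
    (hc : 0 < c) (hT : 0 < T) (hW : MemSobolevW1 1 0 T η) (hη : ContinuousOn η (Icc 0 T))
    (hφ : 0 ≤ φ₀) (h0 : 0 ≤ η 0) (h : RelaxationInequality α c T η fun _ => φ₀) {t : ℝ}
    (ht : t ∈ Ioc 0 T) : η t ≤ η 0 + φ₀ / c := by
  have hi := (intervalIntegrable_mittagLefflerKernel_sub_mul_rpow hα hα one_pos (-c)
    ht.1).mul_const φ₀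
  have hv := integral_mittagLefflerKernel_sub_mul_rpow hα hα one_pos (-c) ht.1
  simp only [sub_self, Real.rpow_zero, mul_one, Real.Gamma_one, one_mul] at hi hv
  have h1 := h.le_relaxationSolution hα hα1.le hc.le hT hW hη ht hi
  have h2 : ∫ s in (0 : ℝ)..t, relaxationIntegrand α c (fun _ => φ₀) t s
      = mittagLefflerKernel α (-c) (α + 1) t * φ₀ := by
    rw [← hv, ← intervalIntegral.integral_mul_const]
    rfl
  rw [relaxationSolution, h2, ← mittagLefflerKernel_one] at h1
  have hE := mittagLefflerKernel_one_nonneg hα hα1 hc.le ht.1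
  have hF := mittagLefflerKernel_add_one_nonneg hα hα1.le hc.le ht.1
  have hEF := mittagLefflerKernel_one_eq hα c ht.1
  refine h1.trans (add_le_add ?_ ?_)
  · refine mul_le_of_le_one_left h0 ?_
    have := mul_nonneg hc.le hF
    linarith
  · rw [le_div_iff₀ hc]
    calc mittagLefflerKernel α (-c) (α + 1) t * φ₀ * c
        = (1 - mittagLefflerKernel α (-c) 1 t) * φ₀ := by rw [hEF]; ring
      _ ≤ φ₀ := mul_le_of_le_one_left hφ (by linarith)

lemma relaxationIntegrand_one (c : ℝ) (φ : ℝ → ℝ) (t s : ℝ) :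
    relaxationIntegrand 1 c φ t s = Real.exp (-c * (t - s)) * φ s := by
  simp [relaxationIntegrand, mittagLeffler_one_one]

lemma RelaxationInequality.le_of_exp {c c₁ T φ₀ : ℝ} {η : ℝ → ℝ} (hc : 0 ≤ c) (hT : 0 < T)
    (hW : MemSobolevW1 1 0 T η) (hη : ContinuousOn η (Icc 0 T)) (hφ : 0 ≤ φ₀) (hcc : c < c₁)
    (h : RelaxationInequality 1 c T η fun t => φ₀ * Real.exp (-c₁ * t)) {t : ℝ}
    (ht : t ∈ Ioc 0 T) : η t ≤ (η 0 + φ₀ / (c₁ - c)) * Real.exp (-c * t) := by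
  have he : ∀ s, relaxationIntegrand 1 c (fun t => φ₀ * Real.exp (-c₁ * t)) t s
      = φ₀ * Real.exp (-c * t) * Real.exp ((c - c₁) * s) := fun s => by
    rw [relaxationIntegrand_one, mul_left_comm, mul_assoc, ← Real.exp_add, ← Real.exp_add]
    ring_nf
  have hi : IntervalIntegrable (relaxationIntegrand 1 c (fun t => φ₀ * Real.exp (-c₁ * t)) t)
      volume 0 t := by
    rw [funext he]
    exact Continuous.intervalIntegrable (by fun_prop) _ _
  have h1 := h.le_relaxationSolution one_pos le_rfl hc hT hW hη ht hi
  have hne : c - c₁ ≠ 0 := (sub_neg.mpr hcc).ne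
  simp only [relaxationSolution, he, mittagLeffler_one_one, Real.rpow_one] at h1
  rw [intervalIntegral.integral_const_mul, intervalIntegral.integral_comp_mul_left
    (fun s => Real.exp s) hne, integral_exp, mul_zero, Real.exp_zero, smul_eq_mul] at h1
  -- The integral of `exp ((c - c₁) s)` over `(0, t)` is bounded by its value over `(0, ∞)`.
  have h2 : (c - c₁)⁻¹ * (Real.exp ((c - c₁) * t) - 1) ≤ 1 / (c₁ - c) := by
    have h3 : (c - c₁)⁻¹ * (Real.exp ((c - c₁) * t) - 1)
        = (1 - Real.exp ((c - c₁) * t)) / (c₁ - c) := by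
      rw [← neg_sub c₁ c, inv_neg]
      ring
    rw [h3]
    have := Real.exp_pos ((c - c₁) * t)
    have := sub_pos.mpr hcc
    gcongr
    linarith
  have h4 := mul_le_mul_of_nonneg_left h2 (mul_nonneg hφ (Real.exp_pos (-c * t)).le)
  have h5 : φ₀ * Real.exp (-c * t) * (1 / (c₁ - c)) = φ₀ / (c₁ - c) * Real.exp (-c * t) := by ring
  linarith

theorem mainTheorem5 :
    -- fractional order
    (∀ α : ℝ, 0 < α → α < 1 →
      -- a constant depending on `α` only
      ∃ C : ℝ, 0 < C ∧
        ∀ (T c₀ : ℝ) (η : ℝ → ℝ), 0 < T → 0 < c₀ →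
          -- the continuous representative of a function in `W^{1,1}(0,T)`
          MemSobolevW1 1 0 T η → ContinuousOn η (Icc 0 T) →
          (∀ a ∈ Ioo 0 T, ∃ β ∈ Ioo α 1,
            MemSobolevW1 (ENNReal.ofReal (1 / (1 - β))) a T η) →
          -- general right-hand side
          (∀ φ : ℝ → ℝ, RelaxationInequality α c₀ T η φ →
            (∀ t ∈ Ioc 0 T, IntervalIntegrable (relaxationIntegrand α c₀ φ t) volume 0 t →
              η t ≤ relaxationSolution α c₀ (η 0) φ t) ∧
            ((∀ᵐ t ∂(volume.restrict (Ioo 0 T)), 0 ≤ η t) →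
              ∀ t ∈ Ioc 0 T,
                IntervalIntegrable (fun s => (t - s) ^ (α - 1) * φ s) volume 0 t →
                η t ≤ η 0 +
                  (1 / Real.Gamma α) * ∫ s in (0 : ℝ)..t, (t - s) ^ (α - 1) * φ s)) ∧
          -- right-hand side `φ₀ t ^ (-α)`
          (∀ φ₀ : ℝ, RelaxationInequality α c₀ T η (fun t => φ₀ * t ^ (-α)) →
            (0 ≤ η 0 → ∀ t ∈ Ioc 0 T,
              η t ≤ (Real.Gamma (1 + α) * c₀⁻¹ * η 0 + φ₀ * C / c₀) * t ^ (-α)) ∧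
            ((∀ᵐ t ∂(volume.restrict (Ioo 0 T)), 0 ≤ η t) →
              ∀ t ∈ Ioc 0 T, η t ≤ η 0 + φ₀ / (Real.Gamma α * α * (1 - α)))) ∧
          -- constant right-hand side
          (∀ φ₀ : ℝ, 0 ≤ φ₀ → 0 ≤ η 0 → RelaxationInequality α c₀ T η (fun _ => φ₀) →
            ∀ t ∈ Ioc 0 T, η t ≤ η 0 + φ₀ / c₀)) ∧
    -- order one
    (∀ x : ℝ, mittagLeffler 1 1 x = Real.exp x) ∧
    (∀ (T c₀ : ℝ) (η : ℝ → ℝ), 0 < T → 0 < c₀ →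
      MemSobolevW1 1 0 T η → ContinuousOn η (Icc 0 T) →
      (∀ φ : ℝ → ℝ, RelaxationInequality 1 c₀ T η φ →
        ∀ t ∈ Ioc 0 T, IntervalIntegrable (relaxationIntegrand 1 c₀ φ t) volume 0 t →
          η t ≤ relaxationSolution 1 c₀ (η 0) φ t) ∧
      (∀ φ₀ c₁ : ℝ, 0 ≤ φ₀ → c₀ < c₁ →
        RelaxationInequality 1 c₀ T η (fun t => φ₀ * Real.exp (-c₁ * t)) →
        ∀ t ∈ Ioc 0 T, η t ≤ (η 0 + φ₀ / (c₁ - c₀)) * Real.exp (-c₀ * t))) := by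
  -- The first factor comes from convolving `e` with `s ^ (-α)`, the second from the decay of `E`.
  refine ⟨fun α hα hα1 => ⟨Real.Gamma (1 - α) * Real.Gamma (1 + α),
    mul_pos (Real.Gamma_pos_of_pos (sub_pos.mpr hα1)) (Real.Gamma_pos_of_pos (by linarith)), ?_⟩,
    mittagLeffler_one_one, ?_⟩
  · intro T c₀ η hT hc hW hη _
    refine ⟨fun φ h => ⟨fun t ht hi => ?_, fun hpos t ht hi => ?_⟩,
      fun φ₀ h => ⟨fun h0 t ht => ?_, fun hpos t ht => ?_⟩, fun φ₀ hφ h0 h t ht => ?_⟩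
    · exact h.le_relaxationSolution hα hα1.le hc.le hT hW hη ht hi
    · exact h.le_fractionalIntegral hα hα1.le hc.le hT hW hη hpos ht hi
    · exact h.le_rpow_of_rpow hα hα1 hc hT hW hη h0 ht
    · exact h.le_of_rpow_of_nonneg hα hα1 hc.le hT hW hη hpos ht
    · exact h.le_of_const hα hα1 hc hT hW hη hφ h0 ht
  · intro T c₀ η hT hc hW hη
    exact ⟨fun φ h t ht hi => h.le_relaxationSolution one_pos le_rfl hc.le hT hW hη ht hi,
      fun φ₀ c₁ hφ hcc h t ht => h.le_of_exp hc.le hT hW hη hφ hcc ht⟩
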